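/- **Theorem 1.1 (depth-estimate).** Let $(R,\mathfrak m)$ be a Cohen–Macaulay local ring (in particular Noetherian), let $I \subsetneq R$ be a proper ideal, and let $\mathbf y = y_1,\dots,y_l$ be any finite sequence of generators of $I$. Set $g = \operatorname{grade}(I)$, the maximal length of an $R$-regular sequence contained in $I$, and for $n \in \mathbb Z$ let $H_n(I) = H_n(\mathbf y, R)$ denote the $n$-th homology module of the Koszul complex of $\mathbf y$ with coefficients in $R$ (so $H_n(I) = 0$ for $n < 0$). Then $$\operatorname{depth} H_{l-g-1}(I) \;\ge\; \min\{\,2,\ \operatorname{depth} H_{l-g}(I) - 2\,\},$$ where the depth of a nonzero finitely generated $R$-module $M$ is the maximal length of an $M$-regular sequence contained in $\mathfrak m$, and the depth of the zero module is $\infty$. -/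

import Mathlib

universe u

/-- The grade of the ideal `I` on the module `M`: the supremum of the lengths of the `M`-regular
sequences contained in `I`, and `∞` if `I M = M` (in particular if `M = 0`). -/
noncomputable def gradeOn {R : Type*} [CommRing R] (I : Ideal R)
    (M : Type*) [AddCommGroup M] [Module R M] : ℕ∞ :=
  open Classical in
  if I • (⊤ : Submodule R M) = ⊤ then ⊤
  else ⨆ (rs : List R) (_ : (∀ r ∈ rs, r ∈ I) ∧ RingTheory.Sequence.IsRegular M rs),
    (rs.length : ℕ∞)

/-- The depth of a module over a local ring: its grade with respect to the maximal ideal.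
The zero module has depth `∞`. -/
noncomputable def depthOf (R : Type*) [CommRing R] [IsLocalRing R]
    (M : Type*) [AddCommGroup M] [Module R M] : ℕ∞ :=
  gradeOn (IsLocalRing.maximalIdeal R) M

/-- A local ring is Cohen-Macaulay if it is Noetherian and its depth equals its Krull dimension. -/
structure IsCohenMacaulayLocal (R : Type*) [CommRing R] [IsLocalRing R] : Prop where
  isNoetherianRing : IsNoetherianRing R
  depth_eq_dim : ((depthOf R R : ℕ∞) : WithBot ℕ∞) = ringKrullDim R

/-- The sign `(-1) ^ #{b ∈ S | b < a}` with which `e_S` occurs in the contraction of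
`e_{S ∪ {a}}`, for `a ∉ S`. -/
def koszulSign {l : ℕ} (a : Fin l) (S : Finset (Fin l)) : ℤ :=
  (-1) ^ (S.filter (fun b => b < a)).card

/-- The chains of degree `n` of the Koszul complex on `l` elements with coefficients in `M`:
the element `f` stands for `∑ f S • e_S`, where `S = {s₁ < ⋯ < sₙ}` runs through the subsets of
`{0, …, l - 1}` with `n` elements and `e_S = e_{s₁} ∧ ⋯ ∧ e_{sₙ}`. It is zero for `n < 0`. -/
abbrev KoszulChain (l : ℕ) (M : Type*) (n : ℤ) : Type _ :=
  {S : Finset (Fin l) // (S.card : ℤ) = n} → M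

/-- The Koszul differential from degree `m` to degree `n`, which is
`e_{s₁} ∧ ⋯ ∧ e_{sₘ} ↦ ∑ₖ (-1) ^ (k - 1) y_{sₖ} e_{s₁} ∧ ⋯ (omit e_{sₖ}) ⋯ ∧ e_{sₘ}`
if `m = n + 1`, and zero otherwise. In coordinates, the coefficient at `S` of the image of `f` is
`∑_{a ∉ S} ± y_a • f (S ∪ {a})`. -/
def koszulDifferential {R : Type*} [CommRing R] {l : ℕ} (y : Fin l → R)
    (M : Type*) [AddCommGroup M] [Module R M] (m n : ℤ) :
    KoszulChain l M m →ₗ[R] KoszulChain l M n where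
  toFun f S := ∑ a : Fin l,
    if h : a ∉ S.1 ∧ ((insert a S.1).card : ℤ) = m then
      koszulSign a S.1 • y a • f ⟨insert a S.1, h.2⟩ else 0
  map_add' f g := by
    funext S
    simp only [Pi.add_apply]
    rw [← Finset.sum_add_distrib]
    refine Finset.sum_congr rfl fun a _ => ?_
    split_ifs <;> simp
  map_smul' r f := by
    funext S
    simp only [Pi.smul_apply, RingHom.id_apply]
    rw [Finset.smul_sum]
    refine Finset.sum_congr rfl fun a _ => ?_
    split_ifs
    · rw [smul_comm r (koszulSign a S.1), smul_comm r (y a)]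
    · simp

theorem koszulDifferential_shape {R : Type*} [CommRing R] {l : ℕ} (y : Fin l → R)
    (M : Type*) [AddCommGroup M] [Module R M] (m n : ℤ) (hmn : n + 1 ≠ m) :
    koszulDifferential y M m n = 0 := by
  refine LinearMap.ext fun f => funext fun S => ?_
  simp only [koszulDifferential, LinearMap.coe_mk, AddHom.coe_mk, LinearMap.zero_apply,
    Pi.zero_apply]
  refine Finset.sum_eq_zero fun a _ => dif_neg ?_
  rintro ⟨ha, hc⟩
  rw [Finset.card_insert_of_notMem ha] at hc
  have := S.2
  push_cast at hc
  omega

theorem koszulSign_insert_lt {l : ℕ} {a b : Fin l} {S : Finset (Fin l)} (ha : a ∉ S)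
    (hab : a < b) : koszulSign b (insert a S) = - koszulSign b S := by
  unfold koszulSign
  rw [Finset.filter_insert, if_pos hab, Finset.card_insert_of_notMem (by simp [ha]), pow_succ]
  ring

theorem koszulSign_insert_not_lt {l : ℕ} {a b : Fin l} {S : Finset (Fin l)}
    (hab : ¬ a < b) : koszulSign b (insert a S) = koszulSign b S := by
  unfold koszulSign
  rw [Finset.filter_insert, if_neg hab]

theorem koszulSign_anticomm {l : ℕ} {a b : Fin l} {S : Finset (Fin l)} (ha : a ∉ S) (hb : b ∉ S)
    (hab : a ≠ b) :
    koszulSign a S * koszulSign b (insert a S) = - (koszulSign b S * koszulSign a (insert b S)) := by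
  rcases lt_or_gt_of_ne hab with h | h
  · rw [koszulSign_insert_lt ha h, koszulSign_insert_not_lt (not_lt_of_gt h)]
    ring
  · rw [koszulSign_insert_lt hb h, koszulSign_insert_not_lt (not_lt_of_gt h)]
    ring

theorem koszulDifferential_comp {R : Type*} [CommRing R] {l : ℕ} (y : Fin l → R)
    (M : Type*) [AddCommGroup M] [Module R M] (m n p : ℤ) :
    koszulDifferential y M n p ∘ₗ koszulDifferential y M m n = 0 := by
  refine LinearMap.ext fun f => funext fun S => ?_
  let t : Fin l × Fin l → M := fun x =>
    if h : (x.1 ∉ S.1 ∧ ((insert x.1 S.1).card : ℤ) = n) ∧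
        (x.2 ∉ insert x.1 S.1 ∧ ((insert x.2 (insert x.1 S.1)).card : ℤ) = m) then
      (koszulSign x.1 S.1 * koszulSign x.2 (insert x.1 S.1)) •
        (y x.1 * y x.2) • f ⟨insert x.2 (insert x.1 S.1), h.2.2⟩
    else 0
  have key : (koszulDifferential y M n p ∘ₗ koszulDifferential y M m n) f S = ∑ x, t x := by
    rw [Fintype.sum_prod_type]
    simp only [koszulDifferential, LinearMap.coe_comp, Function.comp_apply, LinearMap.coe_mk,
      AddHom.coe_mk]
    refine Finset.sum_congr rfl fun a _ => ?_
    by_cases h1 : a ∉ S.1 ∧ ((insert a S.1).card : ℤ) = n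
    · rw [dif_pos h1, Finset.smul_sum, Finset.smul_sum]
      refine Finset.sum_congr rfl fun b _ => ?_
      by_cases h2 : b ∉ insert a S.1 ∧ ((insert b (insert a S.1)).card : ℤ) = m
      · rw [dif_pos h2]
        simp only [t]
        rw [dif_pos ⟨h1, h2⟩, smul_comm (y a) (koszulSign b _), smul_smul, smul_smul]
      · rw [dif_neg h2]
        simp only [t]
        rw [dif_neg fun h => h2 h.2, smul_zero, smul_zero]
    · rw [dif_neg h1]
      refine (Finset.sum_eq_zero fun b _ => ?_).symm
      simp only [t]
      rw [dif_neg fun h => h1 h.1]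
  rw [key]
  refine Finset.sum_involution (fun x _ => x.swap) ?_ ?_ (fun _ _ => Finset.mem_univ _)
    (fun x _ => Prod.swap_swap x)
  · rintro ⟨a, b⟩ -
    simp only [t, Prod.swap_prod_mk]
    by_cases h : (a ∉ S.1 ∧ ((insert a S.1).card : ℤ) = n) ∧
        (b ∉ insert a S.1 ∧ ((insert b (insert a S.1)).card : ℤ) = m)
    · obtain ⟨⟨ha, hn⟩, hb', hm⟩ := h
      have hab : a ≠ b := fun e => hb' (by simp [e])
      have hb : b ∉ S.1 := fun e => hb' (by simp [e])
      have h' : (b ∉ S.1 ∧ ((insert b S.1).card : ℤ) = n) ∧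
          (a ∉ insert b S.1 ∧ ((insert a (insert b S.1)).card : ℤ) = m) := by
        refine ⟨⟨hb, ?_⟩, by simp [ha, hab], ?_⟩
        · rw [Finset.card_insert_of_notMem hb, ← Finset.card_insert_of_notMem ha]
          exact hn
        · rw [Finset.insert_comm]
          exact hm
      have e : (⟨insert a (insert b S.1), h'.2.2⟩ : {S : Finset (Fin l) // (S.card : ℤ) = m}) =
          ⟨insert b (insert a S.1), hm⟩ := Subtype.ext (Finset.insert_comm _ _ _)
      rw [dif_pos ⟨⟨ha, hn⟩, hb', hm⟩, dif_pos h', e, koszulSign_anticomm ha hb hab,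
        mul_comm (y a) (y b), neg_smul, neg_add_cancel]
    · rw [dif_neg h, dif_neg, add_zero]
      rintro ⟨⟨hb, hn⟩, ha', hm⟩
      have hab : b ≠ a := fun e => ha' (by simp [e])
      have ha : a ∉ S.1 := fun e => ha' (by simp [e])
      refine h ⟨⟨ha, ?_⟩, by simp [hb, hab], ?_⟩
      · rw [Finset.card_insert_of_notMem ha, ← Finset.card_insert_of_notMem hb]
        exact hn
      · rw [Finset.insert_comm]
        exact hm
  · rintro ⟨a, b⟩ - hne e
    apply hne
    have hab : b = a := congrArg Prod.fst e
    simp only [t]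
    rw [dif_neg]
    rintro ⟨-, hb', -⟩
    exact hb' (by simp [hab])

/-- The Koszul complex of `y₁, …, y_l` with coefficients in `M`, as a chain complex of
`R`-modules indexed by `ℤ`. -/
noncomputable def koszulComplex {R : Type u} [CommRing R] {l : ℕ} (y : Fin l → R)
    (M : Type u) [AddCommGroup M] [Module R M] : ChainComplex (ModuleCat.{u} R) ℤ where
  X n := ModuleCat.of R (KoszulChain l M n)
  d m n := ModuleCat.ofHom (koszulDifferential y M m n)
  shape m n h := by
    rw [koszulDifferential_shape y M m n h]
    rfl
  d_comp_d' m n p _ _ := by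
    rw [← ModuleCat.ofHom_comp, koszulDifferential_comp]
    rfl

/-- The `n`-th Koszul homology module `H_n(y₁, …, y_l; M)`; it is zero for `n < 0`. -/
noncomputable abbrev koszulHomology {R : Type u} [CommRing R] {l : ℕ} (y : Fin l → R)
    (M : Type u) [AddCommGroup M] [Module R M] (n : ℤ) : ModuleCat.{u} R :=
  (koszulComplex y M).homology n

/-! Depth is measured by vanishing: for generators `z` of the maximal ideal, a finite `M` has depth
at least `k` iff its Koszul homology on `z` vanishes in degrees above `r - k`, `r` being the number
of generators (`le_gradeOn_iff`). The depth inequalities along short exact sequences then come from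
the long homology sequence.

Let `B`, `Z`, `H` be the boundaries, cycles and homology of the Koszul complex on `y`, and `d` the
depth of `R`. The complex is exact above degree `l - g`, so splitting it into short exact sequences
gives `B_{l-g}` depth at least `d + 1 - g`. Now `H_{l-g}` is nonzero and killed by a regular
sequence of length `g`, so its depth is at most `dim R - g`, which is `d - g` by the Cohen–Macaulay
hypothesis. If its depth is at least `k + 2` with `0 < k ≤ 2`, then so is that of `Z_{l-g}`, an
extension of `H_{l-g}` by `B_{l-g}`. Hence `B_{l-g-1}`, the quotient of a free module by `Z_{l-g}`,
has depth at least `k + 1`. Being the kernel of a map of free modules, `Z_{l-g-1}` has depth at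
least `k`, and so has its quotient `H_{l-g-1}`. -/

open Function

section Koszul

variable {R : Type*} [CommRing R] {l : ℕ} (y : Fin l → R)

/-! ### Functoriality in the coefficients -/

section Functoriality

variable {M N P : Type*} [AddCommGroup M] [Module R M] [AddCommGroup N] [Module R N]
  [AddCommGroup P] [Module R P]

/-- The map induced on Koszul chains by a linear map of the coefficients. -/
abbrev KoszulChain.map (l : ℕ) (φ : M →ₗ[R] N) (n : ℤ) :
    KoszulChain l M n →ₗ[R] KoszulChain l N n :=
  φ.compLeft _

theorem koszulDifferential_map (φ : M →ₗ[R] N) (m n : ℤ) (f : KoszulChain l M m) :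
    koszulDifferential y N m n (KoszulChain.map l φ m f) =
      KoszulChain.map l φ n (koszulDifferential y M m n f) := by
  funext S
  simp only [koszulDifferential, LinearMap.coe_mk, AddHom.coe_mk, LinearMap.compLeft_apply,
    comp_apply, map_sum]
  refine Finset.sum_congr rfl fun a _ => ?_
  split_ifs <;> simp

theorem KoszulChain.map_injective {φ : M →ₗ[R] N} (h : Injective φ) (n : ℤ) :
    Injective (KoszulChain.map l φ n) :=
  h.comp_left

theorem KoszulChain.map_surjective {φ : M →ₗ[R] N} (h : Surjective φ) (n : ℤ) :
    Surjective (KoszulChain.map l φ n) :=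
  h.comp_left

theorem KoszulChain.map_exact {φ : M →ₗ[R] N} {ψ : N →ₗ[R] P} (h : Exact φ ψ) (n : ℤ) :
    Exact (KoszulChain.map l φ n) (KoszulChain.map l ψ n) := by
  intro f
  constructor
  · intro hf
    choose a ha using fun S => (h (f S)).1 (congrFun hf S)
    exact ⟨a, funext ha⟩
  · rintro ⟨a, rfl⟩
    exact funext fun S => h.apply_apply_eq_zero (a S)

theorem koszulDifferential_koszulDifferential (m n p : ℤ) (f : KoszulChain l M m) :
    koszulDifferential y M n p (koszulDifferential y M m n f) = 0 :=
  LinearMap.congr_fun (koszulDifferential_comp y M m n p) f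

theorem KoszulChain.subsingleton_of_lt {M : Type*} {n : ℤ} (h : (l : ℤ) < n) :
    Subsingleton (KoszulChain l M n) := by
  have : IsEmpty {S : Finset (Fin l) // (S.card : ℤ) = n} := by
    refine ⟨fun S => ?_⟩
    have h₁ := S.2
    have h₂ := Finset.card_le_univ S.1
    rw [Fintype.card_fin] at h₂
    omega
  infer_instance

end Functoriality

/-! ### The ideal kills Koszul homology -/

section Homotopy

variable {M : Type*} [AddCommGroup M] [Module R M]

theorem koszulSign_mul_self (a : Fin l) (S : Finset (Fin l)) :
    koszulSign a S * koszulSign a S = 1 := by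
  unfold koszulSign
  rw [← pow_add, ← two_mul, pow_mul]
  simp

/-- Extension of a Koszul chain by zero to all subsets. -/
def KoszulChain.extend {n : ℤ} (f : KoszulChain l M n) (S : Finset (Fin l)) : M :=
  if h : (S.card : ℤ) = n then f ⟨S, h⟩ else 0

theorem KoszulChain.extend_coe {n : ℤ} (f : KoszulChain l M n)
    (S : {S : Finset (Fin l) // (S.card : ℤ) = n}) : f.extend S.1 = f S :=
  dif_pos S.2

theorem koszulDifferential_apply {m n : ℤ} (f : KoszulChain l M m)
    (S : {S : Finset (Fin l) // (S.card : ℤ) = n}) :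
    koszulDifferential y M m n f S =
      ∑ a, if a ∉ S.1 then koszulSign a S.1 • y a • f.extend (insert a S.1) else 0 := by
  simp only [koszulDifferential, LinearMap.coe_mk, AddHom.coe_mk]
  refine Finset.sum_congr rfl fun a _ => ?_
  by_cases ha : a ∉ S.1 <;> by_cases hc : ((insert a S.1).card : ℤ) = m <;>
    simp [ha, hc, KoszulChain.extend]

/-- Multiplication by `y a` is null-homotopic on the Koszul complex: it maps cycles to
boundaries. -/
theorem exists_koszulDifferential_eq_smul_apply {m n p : ℤ} (hm : n + 1 = m) (hp : p + 1 = n)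
    (f : KoszulChain l M n) (hf : koszulDifferential y M n p f = 0) (a : Fin l) :
    ∃ h, koszulDifferential y M m n h = y a • f := by
  -- The homotopy is the wedge product with `e_a`.
  let h : KoszulChain l M m := fun T =>
    if a ∈ T.1 then koszulSign a (T.1.erase a) • f.extend (T.1.erase a) else 0
  refine ⟨h, funext fun S => ?_⟩
  have hext (b : Fin l) (hb : b ∉ S.1) : h.extend (insert b S.1) =
      if a ∈ insert b S.1 then
        koszulSign a ((insert b S.1).erase a) • f.extend ((insert b S.1).erase a) else 0 := by
    refine dif_pos ?_
    rw [Finset.card_insert_of_notMem hb]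
    have := S.2
    push_cast
    omega
  rw [koszulDifferential_apply, Pi.smul_apply, ← f.extend_coe S]
  by_cases ha : a ∈ S.1
  · have hcard : ((S.1.erase a).card : ℤ) = p := by
      have h₁ := Finset.card_erase_add_one ha
      have h₂ := S.2
      omega
    -- For `a ∈ S` the term `b = a` is missing from the differential of `h` at `S`; the cycle
    -- condition at `S \ {a}` supplies it and cancels the other terms.
    have hz := congrFun hf ⟨S.1.erase a, hcard⟩
    rw [koszulDifferential_apply] at hz
    have hz' := congrArg (fun t => koszulSign a (S.1.erase a) • t) hz
    simp only [Pi.zero_apply, smul_zero, Finset.smul_sum] at hz'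
    have hs := Finset.sum_ite_eq' Finset.univ a (fun b => y b • f.extend S.1)
    simp only [Finset.mem_univ, if_true] at hs
    rw [← hs]
    refine (add_zero _).symm.trans ((congrArg (_ + ·) hz'.symm).trans ?_)
    rw [← Finset.sum_add_distrib]
    refine Finset.sum_congr rfl fun b _ => ?_
    by_cases hba : b = a
    · subst hba
      simp only [ha, not_true, if_false, if_true, zero_add, Finset.mem_erase, ne_eq,
        false_and, not_false_eq_true, Finset.insert_erase ha, smul_smul, koszulSign_mul_self,
        one_smul]
    · by_cases hb : b ∈ S.1
      · simp [hb, hba]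
      · have e₁ : (insert b S.1).erase a = insert b (S.1.erase a) :=
          Finset.erase_insert_of_ne hba
        have hb' : b ∉ S.1.erase a := fun h => hb (Finset.mem_of_mem_erase h)
        have e₂ : insert a (S.1.erase a) = S.1 := Finset.insert_erase ha
        have hsgn := koszulSign_anticomm (Finset.notMem_erase a S.1) hb' (Ne.symm hba)
        rw [e₂] at hsgn
        rw [if_pos hb, hext b hb, if_pos (Finset.mem_insert_of_mem ha), if_pos hb', if_neg hba, e₁,
          smul_comm (y b) (koszulSign a _), smul_smul, smul_smul, ← add_smul]
        suffices koszulSign b S.1 * koszulSign a (insert b (S.1.erase a)) +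
            koszulSign a (S.1.erase a) * koszulSign b (S.1.erase a) = 0 by rw [this, zero_smul]
        have h₁ := koszulSign_mul_self b S.1
        have h₂ := koszulSign_mul_self b (S.1.erase a)
        linear_combination koszulSign b S.1 * koszulSign b (S.1.erase a) * hsgn -
          koszulSign a (S.1.erase a) * koszulSign b (S.1.erase a) * h₁ -
          koszulSign b S.1 * koszulSign a (insert b (S.1.erase a)) * h₂
  · rw [Finset.sum_eq_single a]
    · rw [if_pos ha, hext a ha, if_pos (Finset.mem_insert_self _ _), Finset.erase_insert ha,
        smul_comm (y a), smul_smul, koszulSign_mul_self, one_smul]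
    · intro b _ hb
      by_cases hbS : b ∈ S.1
      · simp [hbS]
      · rw [if_pos hbS, hext b hbS, if_neg, smul_zero, smul_zero]
        simp [ha, Ne.symm hb]
    · simp

theorem exists_koszulDifferential_eq_smul {m n p : ℤ} (hm : n + 1 = m) (hp : p + 1 = n)
    (f : KoszulChain l M n) (hf : koszulDifferential y M n p f = 0) {x : R}
    (hx : x ∈ Ideal.span (Set.range y)) :
    ∃ h, koszulDifferential y M m n h = x • f := by
  suffices Ideal.span (Set.range y) ≤
      (LinearMap.range (koszulDifferential y M m n)).comap (LinearMap.toSpanSingleton R _ f) from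
    this hx
  refine Ideal.span_le.2 ?_
  rintro _ ⟨a, rfl⟩
  exact exists_koszulDifferential_eq_smul_apply y hm hp f hf a

end Homotopy

/-- Exactness of the Koszul complex of `y` with coefficients in `M` in degree `n`. -/
def KoszulExactAt (M : Type*) [AddCommGroup M] [Module R M] (n : ℤ) : Prop :=
  ∀ m p : ℤ, n + 1 = m → p + 1 = n → ∀ f, koszulDifferential y M n p f = 0 →
    ∃ h, koszulDifferential y M m n h = f

/-- The Koszul complex of `y = y₁, …, y_l` with coefficients in `M` is exact in all degrees greater
than `l - k`. -/
def KoszulDepthGE (M : Type*) [AddCommGroup M] [Module R M] (k : ℕ) : Prop :=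
  ∀ n : ℤ, (l : ℤ) - k < n → KoszulExactAt y M n

/-! ### Depth inequalities in short exact sequences -/

section Exactness

variable {y} {A B C : Type*} [AddCommGroup A] [Module R A] [AddCommGroup B] [Module R B]
  [AddCommGroup C] [Module R C] {ι : A →ₗ[R] B} {π : B →ₗ[R] C}

/-- This and its companions `middle` and `right` are three-term pieces of the long exact homology
sequence, chased on chains. -/
theorem KoszulExactAt.left (hι : Injective ι) (hπ : Surjective π) (hex : Exact ι π) {n : ℤ}
    (hB : KoszulExactAt y B n) (hC : KoszulExactAt y C (n + 1)) : KoszulExactAt y A n := by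
  rintro m p rfl hp f hf
  obtain ⟨b, hb⟩ := hB _ p rfl hp (KoszulChain.map l ι n f) (by
    rw [koszulDifferential_map, hf, map_zero])
  obtain ⟨c, hc⟩ := hC _ n rfl rfl (KoszulChain.map l π _ b) (by
    rw [koszulDifferential_map, hb, (KoszulChain.map_exact hex n).apply_apply_eq_zero])
  obtain ⟨b', rfl⟩ := KoszulChain.map_surjective hπ _ c
  rw [koszulDifferential_map, eq_comm, ← sub_eq_zero, ← map_sub] at hc
  obtain ⟨a, ha⟩ := ((KoszulChain.map_exact hex _) _).1 hc
  refine ⟨a, KoszulChain.map_injective hι n ?_⟩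
  rw [← koszulDifferential_map, ha, map_sub, koszulDifferential_koszulDifferential, sub_zero, hb]

theorem KoszulExactAt.middle (hex : Exact ι π) (hι : Injective ι) (hπ : Surjective π) {n : ℤ}
    (hA : KoszulExactAt y A n) (hC : KoszulExactAt y C n) : KoszulExactAt y B n := by
  rintro m p hm hp f hf
  obtain ⟨c, hc⟩ := hC m p hm hp (KoszulChain.map l π n f) (by
    rw [koszulDifferential_map, hf, map_zero])
  obtain ⟨b, rfl⟩ := KoszulChain.map_surjective hπ _ c
  rw [koszulDifferential_map, eq_comm, ← sub_eq_zero, ← map_sub] at hc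
  obtain ⟨a, ha⟩ := ((KoszulChain.map_exact hex _) _).1 hc
  obtain ⟨a', rfl⟩ := hA m p hm hp a (KoszulChain.map_injective hι p (by
    rw [← koszulDifferential_map, ha, map_sub, koszulDifferential_koszulDifferential, sub_zero, hf,
      map_zero]))
  refine ⟨KoszulChain.map l ι m a' + b, ?_⟩
  rw [map_add, koszulDifferential_map, ha, sub_add_cancel]

theorem KoszulExactAt.right (hι : Injective ι) (hπ : Surjective π) (hex : Exact ι π) {n : ℤ}
    (hA : KoszulExactAt y A n) (hB : KoszulExactAt y B (n + 1)) : KoszulExactAt y C (n + 1) := by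
  rintro m p rfl hp f hf
  obtain rfl : p = n := by omega
  obtain ⟨b, rfl⟩ := KoszulChain.map_surjective hπ _ f
  rw [koszulDifferential_map] at hf
  obtain ⟨a, ha⟩ := ((KoszulChain.map_exact hex _) _).1 hf
  obtain ⟨a', rfl⟩ := hA _ (p - 1) rfl (by omega) a (KoszulChain.map_injective hι _ (by
    rw [← koszulDifferential_map, ha, koszulDifferential_koszulDifferential, map_zero]))
  rw [← koszulDifferential_map, eq_comm, ← sub_eq_zero, ← map_sub] at ha
  obtain ⟨b', hb'⟩ := hB _ p rfl rfl _ ha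
  refine ⟨KoszulChain.map l π _ b', ?_⟩
  rw [koszulDifferential_map, hb', map_sub, (KoszulChain.map_exact hex _).apply_apply_eq_zero,
    sub_zero]

theorem KoszulExactAt.of_lt {n : ℤ} (h : (l : ℤ) < n) : KoszulExactAt y A n := by
  intro m p _ _ f _
  have := KoszulChain.subsingleton_of_lt (M := A) h
  exact ⟨0, Subsingleton.elim _ _⟩

theorem KoszulDepthGE.mono {j k : ℕ} (hjk : j ≤ k) (h : KoszulDepthGE y A k) :
    KoszulDepthGE y A j :=
  fun n hn => h n (by omega)

theorem KoszulDepthGE.zero : KoszulDepthGE y A 0 :=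
  fun _ hn => KoszulExactAt.of_lt (by simpa using hn)

theorem KoszulDepthGE.of_subsingleton [Subsingleton A] (k : ℕ) : KoszulDepthGE y A k :=
  fun _ _ _ _ _ _ _ _ => ⟨0, Subsingleton.elim _ _⟩

theorem KoszulDepthGE.left (hι : Injective ι) (hπ : Surjective π) (hex : Exact ι π) {j k : ℕ}
    (hB : KoszulDepthGE y B k) (hC : KoszulDepthGE y C j) (hkj : k ≤ j + 1) :
    KoszulDepthGE y A k :=
  fun n hn => .left hι hπ hex (hB n hn) (hC _ (by omega))

theorem KoszulDepthGE.middle (hι : Injective ι) (hπ : Surjective π) (hex : Exact ι π) {k : ℕ}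
    (hA : KoszulDepthGE y A k) (hC : KoszulDepthGE y C k) : KoszulDepthGE y B k :=
  fun n hn => .middle hex hι hπ (hA n hn) (hC n hn)

theorem KoszulDepthGE.right (hι : Injective ι) (hπ : Surjective π) (hex : Exact ι π) {k : ℕ}
    (hA : KoszulDepthGE y A (k + 1)) (hB : KoszulDepthGE y B k) : KoszulDepthGE y C k := by
  intro n hn
  obtain ⟨n, rfl⟩ : ∃ n', n = n' + 1 := ⟨n - 1, by omega⟩
  exact .right hι hπ hex (hA n (by push_cast; omega)) (hB _ hn)

/-- Lets the depth of `R` bound that of the Koszul chain modules, which are powers of `R`. -/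
theorem KoszulDepthGE.pi {k : ℕ} (h : KoszulDepthGE y A k) (κ : Type*) :
    KoszulDepthGE y (κ → A) k := by
  intro n hn m p hm hp f hf
  choose c hc using fun i : κ => h n hn m p hm hp (KoszulChain.map l (LinearMap.proj i) n f) (by
    rw [koszulDifferential_map, hf, map_zero])
  refine ⟨fun S i => c i S, funext fun S => funext fun i => ?_⟩
  refine Eq.trans ?_ (congrFun (hc i) S)
  exact congrFun (koszulDifferential_map y (LinearMap.proj (R := R) (φ := fun _ : κ => A) i) m n
    (fun S i => c i S)).symm S

/-- The image of `φ` inherits depth 1 as a submodule of `B`, and a kernel can exceed the image by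
one: hence the bound 2. -/
theorem KoszulDepthGE.ker {k : ℕ} (φ : A →ₗ[R] B) (hk : k ≤ 2) (hA : KoszulDepthGE y A k)
    (hB : KoszulDepthGE y B 1) : KoszulDepthGE y (LinearMap.ker φ) k := by
  have hrange : KoszulDepthGE y (LinearMap.range φ) 1 :=
    .left (LinearMap.range φ).injective_subtype (LinearMap.range φ).mkQ_surjective
      (LinearMap.exact_subtype_mkQ _) hB .zero le_rfl
  exact .left (ι := (LinearMap.ker φ).subtype) (π := φ.rangeRestrict)
    (LinearMap.ker φ).injective_subtype φ.surjective_rangeRestrict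
    (LinearMap.exact_iff.2 (by simp)) hA hrange hk

end Exactness

/-! ### Koszul exactness and regular sequences -/

section Regular

open scoped Pointwise

variable {y} {M : Type*} [AddCommGroup M] [Module R M]

theorem exact_lsmul_mkQ (M : Type*) [AddCommGroup M] [Module R M] (x : R) :
    Exact (LinearMap.lsmul R M x) (x • (⊤ : Submodule R M)).mkQ := by
  intro m
  simp [Submodule.mem_smul_pointwise_iff_exists]

theorem KoszulDepthGE.quotSMulTop {x : R} (hx : IsSMulRegular M x) {k : ℕ}
    (h : KoszulDepthGE y M (k + 1)) : KoszulDepthGE y (QuotSMulTop x M) k :=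
  .right (ι := LinearMap.lsmul R M x) hx (Submodule.mkQ_surjective _) (exact_lsmul_mkQ M x) h
    (h.mono k.le_succ)

/-- Multiplication by `x` is injective on `M` but zero on Koszul homology, so `H_{n+1}(M/xM)` maps
onto `H_n(M)`. -/
theorem KoszulDepthGE.of_quotSMulTop {x : R} (hxy : x ∈ Ideal.span (Set.range y))
    (hx : IsSMulRegular M x) {k : ℕ} (h : KoszulDepthGE y (QuotSMulTop x M) k) :
    KoszulDepthGE y M (k + 1) := by
  rintro n hn m p rfl hp f hf
  have hex := exact_lsmul_mkQ M x
  obtain ⟨b, hb⟩ := exists_koszulDifferential_eq_smul y rfl hp f hf hxy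
  replace hb : koszulDifferential y M _ n b = KoszulChain.map l (LinearMap.lsmul R M x) n f := hb
  obtain ⟨c, hc⟩ := h (n + 1) (by push_cast at hn; omega) _ n rfl rfl
    (KoszulChain.map l (Submodule.mkQ _) _ b) (by
      rw [koszulDifferential_map, hb, (KoszulChain.map_exact hex n).apply_apply_eq_zero])
  obtain ⟨b', rfl⟩ := KoszulChain.map_surjective (Submodule.mkQ_surjective _) _ c
  rw [koszulDifferential_map, eq_comm, ← sub_eq_zero, ← map_sub] at hc
  obtain ⟨a, ha⟩ := ((KoszulChain.map_exact hex _) _).1 hc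
  refine ⟨a, KoszulChain.map_injective (φ := LinearMap.lsmul R M x) hx n ?_⟩
  rw [← koszulDifferential_map, ha, map_sub, koszulDifferential_koszulDifferential, sub_zero, hb]

theorem KoszulDepthGE.of_isWeaklyRegular (rs : List R) {M : Type u} [AddCommGroup M] [Module R M]
    (hrs : ∀ r ∈ rs, r ∈ Ideal.span (Set.range y))
    (h : RingTheory.Sequence.IsWeaklyRegular M rs) : KoszulDepthGE y M rs.length := by
  induction rs generalizing M with
  | nil => exact .zero
  | cons x rs ih =>
    rw [RingTheory.Sequence.isWeaklyRegular_cons_iff] at h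
    exact .of_quotSMulTop (hrs x (by simp)) h.1 (ih (fun r hr => hrs r (by simp [hr])) h.2)

/-- Otherwise prime avoidance puts the ideal inside an associated prime, the annihilator of some `m
≠ 0`; as every `y a` kills `m`, it is a nonzero cycle in the top degree `l`, where there are no
nonzero boundaries. -/
theorem KoszulDepthGE.exists_isSMulRegular [IsNoetherianRing R] [Module.Finite R M]
    (h : KoszulDepthGE y M 1) : ∃ x ∈ Ideal.span (Set.range y), IsSMulRegular M x := by
  by_contra! hreg
  have hsub : (Ideal.span (Set.range y) : Set R) ⊆ ⋃ p ∈ associatedPrimes R M, p := by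
    rw [biUnion_associatedPrimes_eq_compl_regular]
    exact hreg
  obtain ⟨p, hp, hle⟩ := (Ideal.subset_union_prime_finite (associatedPrimes.finite R M) (f := id)
    0 0 fun _ h _ _ => h.1).1 hsub
  obtain ⟨hprime, m, rfl⟩ := isAssociatedPrime_iff.1 hp
  have hm (a : Fin l) : y a • m = 0 := by
    simpa [Submodule.mem_colon_singleton] using hle (Ideal.subset_span ⟨a, rfl⟩)
  obtain ⟨c, hc⟩ := h l (by simp) _ (l - 1) rfl (by omega) (fun _ => m) (by
    funext S
    simp [koszulDifferential, hm])
  have := KoszulChain.subsingleton_of_lt (l := l) (M := M) (lt_add_one (l : ℤ))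
  rw [Subsingleton.elim c 0, map_zero] at hc
  have hm0 : m = 0 := (congrFun hc ⟨Finset.univ, by simp⟩).symm
  exact hprime.ne_top (by simp [hm0])

theorem KoszulDepthGE.exists_isWeaklyRegular [IsNoetherianRing R] {M : Type u} [AddCommGroup M]
    [Module R M] [Module.Finite R M] {k : ℕ} (h : KoszulDepthGE y M k) :
    ∃ rs : List R, (∀ r ∈ rs, r ∈ Ideal.span (Set.range y)) ∧ rs.length = k ∧
      RingTheory.Sequence.IsWeaklyRegular M rs := by
  induction k generalizing M with
  | zero => exact ⟨[], by simp⟩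
  | succ k ih =>
    obtain ⟨x, hx, hreg⟩ := (h.mono (Nat.le_add_left 1 k)).exists_isSMulRegular
    obtain ⟨rs, hrs, hlen, hw⟩ := ih (h.quotSMulTop hreg)
    refine ⟨x :: rs, ?_, by simp [hlen], ?_⟩
    · simpa [hx] using hrs
    · rw [RingTheory.Sequence.isWeaklyRegular_cons_iff]
      exact ⟨hreg, hw⟩

end Regular

/-! ### Grade via Koszul homology -/

section Grade

variable {y} [IsLocalRing R] {M : Type u} [AddCommGroup M] [Module R M]
  [Module.Finite R M]

theorem exists_isRegular_of_le_gradeOn [Nontrivial M] {I : Ideal R} (hI : I ≠ ⊤) {k : ℕ}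
    (h : (k : ℕ∞) ≤ gradeOn I M) :
    ∃ rs : List R, (∀ r ∈ rs, r ∈ I) ∧ RingTheory.Sequence.IsRegular M rs ∧ k ≤ rs.length := by
  rcases Nat.eq_zero_or_pos k with rfl | hk
  · exact ⟨[], by simp, .nil R M, le_rfl⟩
  -- By Nakayama, the infinite branch of the grade does not occur.
  have hne : I • (⊤ : Submodule R M) ≠ ⊤ := (Submodule.top_ne_ideal_smul_of_le_jacobson_annihilator
    ((IsLocalRing.le_maximalIdeal hI).trans (IsLocalRing.maximalIdeal_le_jacobson _))).symm
  rw [gradeOn, if_neg hne] at h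
  by_contra! hlt
  have hle : (k : ℕ∞) ≤ ((k - 1 : ℕ) : ℕ∞) := h.trans <| iSup₂_le fun rs hrs => by
    have := hlt rs hrs.1 hrs.2
    exact_mod_cast (by omega : rs.length ≤ k - 1)
  have : k ≤ k - 1 := by exact_mod_cast hle
  omega

/-- The Koszul complex is sensitive to grade. -/
theorem le_gradeOn_iff [IsNoetherianRing R] (hI : Ideal.span (Set.range y) ≠ ⊤) {k : ℕ} :
    (k : ℕ∞) ≤ gradeOn (Ideal.span (Set.range y)) M ↔ KoszulDepthGE y M k := by
  rcases subsingleton_or_nontrivial M with hM | hM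
  · rw [gradeOn, if_pos (Subsingleton.elim _ _)]
    exact iff_of_true le_top (.of_subsingleton k)
  constructor
  · intro h
    obtain ⟨rs, hrs, hreg, hk⟩ := exists_isRegular_of_le_gradeOn hI h
    exact (KoszulDepthGE.of_isWeaklyRegular rs hrs hreg.toIsWeaklyRegular).mono hk
  · intro h
    obtain ⟨rs, hrs, rfl, hreg⟩ := h.exists_isWeaklyRegular
    rw [gradeOn]
    split_ifs
    · exact le_top
    · exact le_iSup₂_of_le rs ⟨hrs, .of_isWeaklyRegular_of_mem_maximalIdeal M
        (fun r hr => IsLocalRing.le_maximalIdeal hI (hrs r hr)) hreg⟩ le_rfl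

end Grade

end Koszul

/-! ### Cycles, boundaries and homology modules -/

section Homology

variable {R : Type u} [CommRing R] {l : ℕ} (y : Fin l → R) (M : Type u) [AddCommGroup M]
  [Module R M]

/-- The projection from the Koszul cycles to Koszul homology. -/
theorem exists_koszulHomology_projection {m n p : ℤ} (hm : n + 1 = m) (hp : p + 1 = n) :
    ∃ π : LinearMap.ker (koszulDifferential y M n p) →ₗ[R] koszulHomology y M n,
      Surjective π ∧ ∀ x, π x = 0 ↔ ∃ h, koszulDifferential y M m n h = x := by
  let K := koszulComplex y M
  let S := K.sc' m n p
  let e : S.homology ≅ K.homology n := CategoryTheory.ShortComplex.homologyMapIso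
    (K.isoSc' m n p ((ComplexShape.down ℤ).prev_eq' hm)
      ((ComplexShape.down ℤ).next_eq' hp)).symm
  let e' : (LinearMap.ker S.g.hom ⧸ LinearMap.range S.moduleCatToCycles) ≃ₗ[R] K.homology n :=
    (S.moduleCatHomologyIso.symm ≪≫ e).toLinearEquiv
  have hker (x : LinearMap.ker S.g.hom) : (e'.toLinearMap ∘ₗ Submodule.mkQ _) x = 0 ↔
      x ∈ LinearMap.range S.moduleCatToCycles := by
    rw [LinearMap.comp_apply, LinearEquiv.coe_coe, LinearEquiv.map_eq_zero_iff,
      Submodule.mkQ_apply, Submodule.Quotient.mk_eq_zero]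
  refine ⟨e'.toLinearMap ∘ₗ Submodule.mkQ _, e'.surjective.comp (Submodule.mkQ_surjective _),
    fun x => (hker x).trans ⟨?_, ?_⟩⟩
  · rintro ⟨h, rfl⟩
    exact ⟨h, rfl⟩
  · rintro ⟨h, hh⟩
    exact ⟨h, Subtype.ext hh⟩

variable {y M}

instance [IsNoetherianRing R] [Module.Finite R M] (n : ℤ) :
    Module.Finite R (koszulHomology y M n) := by
  obtain ⟨π, hπ, -⟩ := exists_koszulHomology_projection y M (n := n) (p := n - 1) rfl (by omega)
  exact .of_surjective π hπ

theorem koszulExactAt_of_subsingleton_homology {n : ℤ}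
    (h : Subsingleton (koszulHomology y M n)) : KoszulExactAt y M n := by
  intro m p hm hp f hf
  obtain ⟨π, -, hπ⟩ := exists_koszulHomology_projection y M hm hp
  exact (hπ ⟨f, hf⟩).1 (Subsingleton.elim _ _)

theorem span_le_annihilator_koszulHomology (n : ℤ) :
    Ideal.span (Set.range y) ≤ Module.annihilator R (koszulHomology y M n) := by
  intro x hx
  obtain ⟨π, hπ, hker⟩ :=
    exists_koszulHomology_projection y M (n := n) (p := n - 1) rfl (by omega)
  refine Module.mem_annihilator.2 fun c => ?_
  obtain ⟨f, rfl⟩ := hπ c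
  rw [← map_smul, hker]
  exact exists_koszulDifferential_eq_smul y rfl (by omega) f.1 f.2 hx

/-- The short exact sequence of boundaries, cycles and homology. -/
theorem exists_shortExact_range_ker_homology {m n p : ℤ} (hm : n + 1 = m) (hp : p + 1 = n) :
    ∃ (ι : LinearMap.range (koszulDifferential y M m n) →ₗ[R]
        LinearMap.ker (koszulDifferential y M n p))
      (π : LinearMap.ker (koszulDifferential y M n p) →ₗ[R] koszulHomology y M n),
      Injective ι ∧ Surjective π ∧ Exact ι π := by
  obtain ⟨π, hπ, hker⟩ := exists_koszulHomology_projection y M hm hp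
  have hle : LinearMap.range (koszulDifferential y M m n) ≤
      LinearMap.ker (koszulDifferential y M n p) :=
    LinearMap.range_le_ker_iff.2 (koszulDifferential_comp y M m n p)
  refine ⟨Submodule.inclusion hle, π, Submodule.inclusion_injective hle, hπ, fun x => ?_⟩
  rw [hker]
  constructor
  · rintro ⟨h, hh⟩
    exact ⟨⟨x, h, hh⟩, rfl⟩
  · rintro ⟨⟨_, h, rfl⟩, rfl⟩
    exact ⟨h, rfl⟩

end Homology

/-! ### Depth of the boundaries -/

section Syzygies

variable {R : Type*} [CommRing R] {l r : ℕ} {y : Fin l → R} {z : Fin r → R} {A B : Type*}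
  [AddCommGroup A] [Module R A] [AddCommGroup B] [Module R B]

theorem KoszulDepthGE.range {k : ℕ} (φ : A →ₗ[R] B)
    (hker : KoszulDepthGE z (LinearMap.ker φ) (k + 1))
    (hA : KoszulDepthGE z A k) : KoszulDepthGE z (LinearMap.range φ) k :=
  .right (ι := (LinearMap.ker φ).subtype) (π := φ.rangeRestrict)
    (LinearMap.ker φ).injective_subtype φ.surjective_rangeRestrict
    (LinearMap.exact_iff.2 (by simp)) hker hA

/-- If the Koszul complex of `y` is exact in degrees greater than `l - g`, then the boundaries in
these degrees and in degree `l - g` have large depth. -/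
theorem KoszulDepthGE.range_koszulDifferential {M : Type*} [AddCommGroup M] [Module R M] {d g : ℕ}
    (hgd : g ≤ d) (hd : KoszulDepthGE z M d) (hg : KoszulDepthGE y M g) {j : ℕ} (hj : j ≤ g) :
    KoszulDepthGE z (LinearMap.range (koszulDifferential y M ((l : ℤ) - j + 1) ((l : ℤ) - j)))
      (d + 1 - j) := by
  -- Exactness in degree `l - j` identifies the cycles there with the boundaries already treated, so
  -- each step down costs one unit of depth. The start is the zero module of boundaries in degree
  -- `l`.
  induction j with
  | zero =>
    have := KoszulChain.subsingleton_of_lt (l := l) (M := M) (n := (l : ℤ) - (0 : ℕ) + 1)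
      (by simp)
    have : Subsingleton (LinearMap.range
        (koszulDifferential y M ((l : ℤ) - (0 : ℕ) + 1) ((l : ℤ) - (0 : ℕ)))) :=
      (LinearMap.surjective_rangeRestrict _).subsingleton
    exact .of_subsingleton _
  | succ j ih =>
    have e : (l : ℤ) - (j + 1 : ℕ) + 1 = (l : ℤ) - j := by push_cast; ring
    rw [e]
    refine .range _ ?_ ((hd.pi _).mono (by omega))
    have hker : LinearMap.ker (koszulDifferential y M ((l : ℤ) - j) ((l : ℤ) - (j + 1 : ℕ))) =
        LinearMap.range (koszulDifferential y M ((l : ℤ) - j + 1) ((l : ℤ) - j)) := by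
      refine le_antisymm (fun f hf => ?_)
        (LinearMap.range_le_ker_iff.2 (koszulDifferential_comp y M _ _ _))
      exact hg _ (by omega) _ _ rfl e f hf
    rw [hker]
    exact (ih (by omega)).mono (by omega)

end Syzygies

/-! ### Depth against dimension -/

section Dimension

open RingTheory.Sequence

variable {R : Type*} [CommRing R] [IsLocalRing R] [IsNoetherianRing R]

/-- The depth of a nonzero finite module killed by a regular sequence of length `g` is at most
`dim R - g`. -/
theorem length_add_length_le_ringKrullDim {M : Type*} [AddCommGroup M] [Module R M]
    [Module.Finite R M] {xs rs : List R} (hxs : IsRegular R xs)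
    (hann : Ideal.ofList xs ≤ Module.annihilator R M) (hrs : IsRegular M rs) :
    ((rs.length + xs.length : ℕ) : WithBot ℕ∞) ≤ ringKrullDim R := by
  have := hrs.nontrivial
  have := hrs.quot_ofList_smul_nontrivial ⊤
  have hle : (rs.length : WithBot ℕ∞) ≤ ringKrullDim (R ⧸ Ideal.ofList xs) := by
    calc (rs.length : WithBot ℕ∞)
        ≤ Module.supportDim R (M ⧸ Ideal.ofList rs • (⊤ : Submodule R M)) + rs.length := by
          -- The quotient by `rs` is nonzero, so its support has dimension at least 0.
          refine le_add_of_nonneg_left ?_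
          exact Order.krullDim_nonneg_iff.2 Module.nonempty_support_of_nontrivial.to_subtype
      _ = Module.supportDim R M := Module.supportDim_add_length_eq_supportDim_of_isRegular rs hrs
      _ = ringKrullDim (R ⧸ Module.annihilator R M) :=
          Module.supportDim_eq_ringKrullDim_quotient_annihilator R M
      _ ≤ ringKrullDim (R ⧸ Ideal.ofList xs) :=
          ringKrullDim_le_of_surjective (Ideal.Quotient.factor hann)
            (Ideal.Quotient.factor_surjective hann)
  rw [← ringKrullDim_add_length_eq_ringKrullDim_of_isRegular xs hxs]
  push_cast
  gcongr

end Dimension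

/-! ### The depth estimate -/

theorem theorem1p1 (R : Type u) [CommRing R] [IsLocalRing R] (hR : IsCohenMacaulayLocal R)
    (I : Ideal R) (hI : I ≠ ⊤)
    (l : ℕ) (y : Fin l → R) (hy : Ideal.span (Set.range y) = I)
    (g : ℕ) (hg : gradeOn I R = (g : ℕ∞)) :
    depthOf R (koszulHomology y R ((l : ℤ) - (g : ℤ) - 1)) ≥
      min 2 (depthOf R (koszulHomology y R ((l : ℤ) - (g : ℤ))) - 2) := by
  have := hR.isNoetherianRing
  subst hy
  obtain ⟨r, z, hz⟩ := Submodule.fg_iff_exists_fin_generating_family.1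
    (IsNoetherian.noetherian (IsLocalRing.maximalIdeal R))
  replace hz : Ideal.span (Set.range z) = IsLocalRing.maximalIdeal R := hz
  have hz_ne : Ideal.span (Set.range z) ≠ ⊤ := hz ▸ Ideal.IsPrime.ne_top'
  have hdepth (M : Type u) [AddCommGroup M] [Module R M] [Module.Finite R M] (k : ℕ) :
      (k : ℕ∞) ≤ depthOf R M ↔ KoszulDepthGE z M k := by
    rw [depthOf, ← hz, le_gradeOn_iff hz_ne]
  have hyg : KoszulDepthGE y R g := (le_gradeOn_iff hI).1 hg.ge
  -- If this module vanished, exactness would reach one degree further and the grade would be at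
  -- least `g + 1`.
  have hnt : Nontrivial (koszulHomology y R ((l : ℤ) - g)) := by
    by_contra hsub
    rw [not_nontrivial_iff_subsingleton] at hsub
    have hyg' : KoszulDepthGE y R (g + 1) := by
      intro n hn
      rcases eq_or_ne n ((l : ℤ) - g) with rfl | hne
      · exact koszulExactAt_of_subsingleton_homology hsub
      · exact hyg n (by push_cast at hn; omega)
    rw [← le_gradeOn_iff hI, hg] at hyg'
    have : g + 1 ≤ g := by exact_mod_cast hyg'
    omega
  refine ENat.forall_natCast_le_iff_le.1 fun k hk => ?_
  obtain ⟨hk₂, hk⟩ := le_min_iff.1 hk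
  replace hk₂ : k ≤ 2 := by exact_mod_cast hk₂
  -- Subtraction in `ℕ∞` is truncated: only for `k > 0` does `k ≤ depth - 2` give `k + 2 ≤ depth`.
  rcases Nat.eq_zero_or_pos k with rfl | hk₀
  · simp
  have hH : ((k + 2 : ℕ) : ℕ∞) ≤ depthOf R (koszulHomology y R ((l : ℤ) - g)) := by
    have hne : (k : ℕ∞) ≠ 0 := by exact_mod_cast hk₀.ne'
    rw [Nat.cast_add, Nat.cast_ofNat]
    refine add_le_of_le_tsub_right_of_le ?_ hk
    by_contra! hlt
    rw [tsub_eq_zero_of_le hlt.le] at hk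
    exact hne (le_zero_iff.1 hk)
  obtain ⟨xs, hxs, hxs_reg, hxs_len⟩ := exists_isRegular_of_le_gradeOn hI hg.ge
  obtain ⟨rs, -, hrs_reg, hrs_len⟩ :=
    exists_isRegular_of_le_gradeOn Ideal.IsPrime.ne_top' hH
  have hdim := length_add_length_le_ringKrullDim hxs_reg
    ((Ideal.span_le.2 hxs).trans (span_le_annihilator_koszulHomology ((l : ℤ) - g))) hrs_reg
  rw [← hR.depth_eq_dim] at hdim
  -- Only a lower bound `d` for the depth of `R` is needed: the combined length of the two regular
  -- sequences.
  obtain ⟨d, hd, hdg⟩ : ∃ d : ℕ, KoszulDepthGE z R d ∧ k + 2 + g ≤ d := by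
    refine ⟨rs.length + xs.length, (hdepth R _).1 (by exact_mod_cast hdim), by omega⟩
  rw [hdepth] at hH ⊢
  have hp : (l : ℤ) - g - 1 + 1 = l - g := by ring
  obtain ⟨ι, π, hι, hπ, hex⟩ := exists_shortExact_range_ker_homology (y := y) (M := R)
    (n := (l : ℤ) - g) rfl hp
  have hZ : KoszulDepthGE z
      (LinearMap.ker (koszulDifferential y R ((l : ℤ) - g) ((l : ℤ) - g - 1))) (k + 2) :=
    .middle hι hπ hex ((hd.range_koszulDifferential (by omega) hyg le_rfl).mono (by omega)) hH
  have hB := KoszulDepthGE.range _ hZ ((hd.pi _).mono (by omega))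
  obtain ⟨ι', π', hι', hπ', hex'⟩ := exists_shortExact_range_ker_homology (y := y) (M := R)
    (p := (l : ℤ) - g - 2) hp (by ring)
  exact .right hι' hπ' hex' hB (.ker _ hk₂ ((hd.pi _).mono (by omega)) ((hd.pi _).mono (by omega)))
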